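/- **Setting.** Graphs are finite undirected multigraphs. An $r$-way cut of a graph is a partition of its vertex set into $r$ nonempty clusters, and a cut is an $r$-way cut with $r\ge 2$; its size is the number of crossing edges (edges joining different clusters), and it is compact if every cluster induces a connected subgraph. A *distance-cumulative* property $\Phi$ assigns to each connected graph $G$ with edge weights $w\ge 0$ a real number $\Phi(G)\ge 0$ (and $\Phi(G)=\infty$ if $G$ is disconnected) such that for every connected $G$: - multiplying all weights by $r\ge 0$ multiplies $\Phi(G)$ by $r$; - increasing the weight of one edge by $r\ge0$ does not decrease $\Phi(G)$ and increases it by at most $r$; - $\Phi(G/e)=\Phi(G)$ if $w(e)=0$; - $\Phi(G-e)=\Phi(G)$ if $e\neq e'$ are parallel and $w(e)\ge w(e')$; - if $\Phi(G)>0$, then $\Phi(G)\ge\min_e w(e)$; - $\Phi(G)=0$ if and only if $G$ stays connected after all edges of positive weight are removed. Let $G$ be a connected graph with $n\ge 2$ vertices in which each edge $e$, independently of the others, takes on its heavy phase $W_e^H$ (its weight is then $W_e^H$) with probability $p_e\in(0,1)$ and its light phase $W_e^L$ with probability $1-p_e$, where $W_e^H\ge W_e^L\ge 0$ and $W_e^H>0$.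 Let $X=\Phi(G)$, let $E^0=\{e : W_e^L=0\}$, let $G^0$ be the graph on the vertices of $G$ with edge set $E^0$, and suppose that $p_e=p$ for all $e\in E^0$. Let $\chi$ be the minimum size of a cut of $G^0$. Put $c=(5+\sqrt{17})/2$ and assume that $\Pr[X>0]<n^{-c}$ (in particular, $G^0$ is connected). **Statement.** There is a universal constant $\varepsilon_0>0$ such that, for every $G$, $\Phi$, $p$ as above and every $0<\varepsilon\le\varepsilon_0$, the following holds. Let $$\alpha=\frac{c-1+\ln(1/\varepsilon)/\ln n}{2}$$ and let $\mathcal C$ be the collection of all compact cuts of $G^0$ of size at most $\alpha\chi$. Then the probability that there exists a compact cut $C\notin\mathcal C$ of $G^0$ all of whose crossing edges (in $E^0$) take on their heavy phases is at most $$\frac{\varepsilon\,p^{\chi}}{4}\;\le\;\frac{\varepsilon\cdot\Pr[X>0]}{4}.$$ -/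

import Mathlib

open scoped NNReal ENNReal

universe u v

noncomputable section

/-- An undirected multigraph (parallel edges and loops allowed) with vertex set `V` and edge
set `E`, given by the unordered pair of endpoints of each edge. -/
structure Multigraph (V : Type u) (E : Type v) where
  ends : E → Sym2 V

namespace Multigraph

variable {V : Type u} {E : Type v}

/-- The simple graph of all pairs of distinct vertices that are joined by at least one edge. -/
def toSimple (G : Multigraph V E) : SimpleGraph V :=
  SimpleGraph.fromEdgeSet (Set.range G.ends)

/-- Connectivity (with at least one vertex). Loops and multiplicities are irrelevant. -/
def Connected (G : Multigraph V E) : Prop :=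
  G.toSimple.Connected

/-- The subgraph induced on the vertex set `U` is connected. -/
def ConnectedOn (G : Multigraph V E) (U : Set V) : Prop :=
  (G.toSimple.induce U).Connected

/-- The graph with the same vertices whose edges are the edges of `G` that lie in `S`. -/
def restrict (G : Multigraph V E) (S : Set E) : Multigraph V S where
  ends e := G.ends e

/-- The equivalence relation on vertices that identifies the endpoints of the edge `e`. -/
def contractSetoid (G : Multigraph V E) (e : E) : Setoid V where
  r x y := x = y ∨ (x ∈ G.ends e ∧ y ∈ G.ends e)
  iseqv :=
    { refl := fun _ => Or.inl rfl
      symm := by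
        rintro x y (h | ⟨hx, hy⟩)
        · exact Or.inl h.symm
        · exact Or.inr ⟨hy, hx⟩
      trans := by
        rintro x y z (rfl | ⟨hx, hy⟩) (rfl | ⟨hy', hz⟩)
        · exact Or.inl rfl
        · exact Or.inr ⟨hy', hz⟩
        · exact Or.inr ⟨hx, hy⟩
        · exact Or.inr ⟨hx, hz⟩ }

/-- The contraction `G / e`: the endpoints of `e` are identified and `e` is removed; all other
edges are kept, edges parallel to `e` becoming loops. -/
def contract (G : Multigraph V E) (e : E) :
    Multigraph (Quotient (G.contractSetoid e)) {f : E // f ≠ e} where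
  ends f := Sym2.map (Quotient.mk (G.contractSetoid e)) (G.ends f)

/-! Cuts. A partition of the vertex set is represented by the equivalence relation whose
classes are its clusters. -/

/-- A cut is a partition of the vertex set into at least two (nonempty) clusters. -/
def IsCut (C : Setoid V) : Prop :=
  2 ≤ C.classes.ncard

/-- The set of edges whose endpoints lie in different clusters of `C`. -/
def crossing (G : Multigraph V E) (C : Setoid V) : Set E :=
  {e | ∃ x y, G.ends e = s(x, y) ∧ ¬ C x y}

/-- The size of a cut is the number of its crossing edges. -/
def cutSize (G : Multigraph V E) (C : Setoid V) : ℕ :=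
  (G.crossing C).ncard

/-- A compact cut: every cluster induces a connected subgraph. -/
def IsCompactCut (G : Multigraph V E) (C : Setoid V) : Prop :=
  IsCut C ∧ ∀ U ∈ C.classes, G.ConnectedOn U

/-- The size of a min cut (a cut exists as soon as there are two vertices). -/
def minCutSize (G : Multigraph V E) : ℕ :=
  sInf {k | ∃ C : Setoid V, IsCut C ∧ G.cutSize C = k}

/-- The compact cuts of size at most `b`. -/
def compactCutsUpTo (G : Multigraph V E) (b : ℝ) : Set (Setoid V) :=
  {C | G.IsCompactCut C ∧ (G.cutSize C : ℝ) ≤ b}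

end Multigraph

/-- A finite multigraph with nonnegative real edge weights. -/
structure WeightedGraph where
  V : Type u
  E : Type v
  finV : Finite V
  finE : Finite E
  graph : Multigraph V E
  weight : E → ℝ≥0

namespace WeightedGraph

/-- All weights are multiplied by `r`. -/
def scale (G : WeightedGraph.{u, v}) (r : ℝ≥0) : WeightedGraph.{u, v} :=
  { G with weight := fun e => r * G.weight e }

open Classical in
/-- The weight of the edge `e` is increased by `r`. -/
def increase (G : WeightedGraph.{u, v}) (e : G.E) (r : ℝ≥0) : WeightedGraph.{u, v} :=
  { G with weight := fun f => if f = e then G.weight f + r else G.weight f }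

/-- Contraction of the edge `e`. -/
def contract (G : WeightedGraph.{u, v}) (e : G.E) : WeightedGraph.{u, v} where
  V := Quotient (G.graph.contractSetoid e)
  E := {f : G.E // f ≠ e}
  finV := by
    have := G.finV
    infer_instance
  finE := by
    have := G.finE
    infer_instance
  graph := G.graph.contract e
  weight f := G.weight f

/-- Deletion of the edge `e`. -/
def delete (G : WeightedGraph.{u, v}) (e : G.E) : WeightedGraph.{u, v} where
  V := G.V
  E := ({e}ᶜ : Set G.E)
  finV := G.finV
  finE := by
    have := G.finE
    infer_instance
  graph := G.graph.restrict {e}ᶜ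
  weight f := G.weight f

end WeightedGraph

/-- Distance-cumulative weighted graph properties: a nonnegative real number is assigned to each
connected weighted graph, subject to the requirements below, and `∞` to each disconnected one. -/
structure IsDistanceCumulative (Φ : WeightedGraph.{u, v} → ℝ≥0∞) : Prop where
  ne_top : ∀ G, G.graph.Connected → Φ G ≠ ∞
  eq_top : ∀ G, ¬ G.graph.Connected → Φ G = ∞
  scale : ∀ G, G.graph.Connected → ∀ r : ℝ≥0, Φ (G.scale r) = r * Φ G
  additive : ∀ G, G.graph.Connected → ∀ (e : G.E) (r : ℝ≥0),
    Φ G ≤ Φ (G.increase e r) ∧ Φ (G.increase e r) ≤ Φ G + r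
  contract : ∀ G, G.graph.Connected → ∀ e : G.E, G.weight e = 0 → Φ (G.contract e) = Φ G
  parallel : ∀ G, G.graph.Connected → ∀ e e' : G.E, e ≠ e' → G.graph.ends e = G.graph.ends e' →
    G.weight e' ≤ G.weight e → Φ (G.delete e) = Φ G
  /-- If positive, the value is at least the minimum edge weight. -/
  bounds : ∀ G, G.graph.Connected → 0 < Φ G → ∃ e : G.E, (G.weight e : ℝ≥0∞) ≤ Φ G
  positive : ∀ G, G.graph.Connected →
    (Φ G = 0 ↔ (G.graph.restrict {e | G.weight e = 0}).Connected)

/-- A biased coin weighted graph: independently of the other edges, the edge `e` takes on its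
heavy phase with probability `prob e` and its light phase with probability `1 - prob e`. -/
structure BCWGraph (V : Type u) (E : Type v) where
  graph : Multigraph V E
  heavy : E → ℝ≥0
  light : E → ℝ≥0
  light_le_heavy : ∀ e, light e ≤ heavy e
  prob : E → ℝ
  prob_pos : ∀ e, 0 < prob e
  prob_lt_one : ∀ e, prob e < 1

namespace BCWGraph

variable {V : Type u} {E : Type v}

/-- The weighted graph of an instance `I`, where `I e = true` means that the edge `e` takes on
its heavy phase and `I e = false` that it takes on its light phase. -/
def realize [Finite V] [Finite E] (G : BCWGraph V E) (I : E → Bool) : WeightedGraph.{u, v} where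
  V := V
  E := E
  finV := inferInstance
  finE := inferInstance
  graph := G.graph
  weight e := if I e then G.heavy e else G.light e

open Classical in
/-- The probability of a set `A` of instances: the phases of the edges are independent. -/
def Pr [Fintype E] (G : BCWGraph V E) (A : Set (E → Bool)) : ℝ :=
  ∑ I : E → Bool, if I ∈ A then ∏ e, (if I e then G.prob e else 1 - G.prob e) else 0

/-- The edges whose light phase is zero. -/
def zeroEdges (G : BCWGraph V E) : Set E :=
  {e | G.light e = 0}

/-- The restriction of the graph to the edges whose light phase is zero. -/
def zeroGraph (G : BCWGraph V E) : Multigraph V G.zeroEdges :=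
  G.graph.restrict G.zeroEdges

/-- The event that all edges of the zero graph that cross `C` take on their heavy phases. -/
def AllHeavy (G : BCWGraph V E) (C : Setoid V) : Set (E → Bool) :=
  {I | ∀ e ∈ G.zeroGraph.crossing C, I e = true}

/-- The event that the random value `X = Φ(G)` is strictly positive. -/
def positiveEvent [Finite V] [Finite E] (G : BCWGraph V E) (Φ : WeightedGraph.{u, v} → ℝ≥0∞) :
    Set (E → Bool) :=
  {I | 0 < Φ (G.realize I)}

end BCWGraph

/-- The constant `c = (5 + √17) / 2`. -/
def cutConst : ℝ := (5 + Real.sqrt 17) / 2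

/-- The threshold `α = (c - 1 + ln (1 / ε) / ln n) / 2`. -/
def cutAlpha (n : ℕ) (ε : ℝ) : ℝ := (cutConst - 1 + Real.log (1 / ε) / Real.log n) / 2

end

/-! Write x = p^χ. If all zero edges crossing some cut are heavy, the weight-zero edges cannot
connect the graph, so X > 0. Applied to a minimum cut this gives x ≤ Pr[X > 0] < n^(-c). A cut of
size s is entirely heavy with probability p^s, so a union bound leaves the sum of p^|C| over
partitions with |C| > αχ.

The main estimate is `card_smallCuts_le_rpow`: at most n^(2β) partitions, with any number of
clusters, have size at most βχ. It is Karger's contraction argument as a deterministic double count.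
There are at least nχ/2 non-loop edges, so on average over these edges a small partition survives
contraction with proportion at least 1 - 2β/n. One iterates down to ⌈2β⌉ vertices and there bounds
all partitions by a factorial. Edges are kept as a pair of end maps `f g : E → V`, so contraction is
composition with a vertex map and `E` never changes.

Grouping cuts by size turns this count into a geometric series (`sum_pow_crossEdges_le`) bounded by
a constant times (n²x)^α. The value of c is the root that makes this at most εx/4 (`tail_le`). -/

/-! ### Counting partitions of a finite set -/

instance Setoid.finite_of_finite (V : Type u) [Finite V] : Finite (Setoid V) :=
  Finite.of_injective (fun C : Setoid V => fun x y => C x y) fun C D h => by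
    ext x y
    exact iff_of_eq (congrFun (congrFun h x) y)

/-- A finite type with `n` elements has at most `n!` equivalence relations. -/
theorem Setoid.card_le_factorial (V : Type u) [Finite V] :
    Nat.card (Setoid V) ≤ (Nat.card V).factorial := by
  induction V using Finite.induction_empty_option with
  | @of_equiv α β e ih =>
    let F : Setoid α ≃ Setoid β :=
      { toFun := Setoid.comap e.symm
        invFun := Setoid.comap e
        left_inv := fun C => by ext x y; simp [Setoid.comap_rel]
        right_inv := fun C => by ext x y; simp [Setoid.comap_rel] }
    rwa [← Nat.card_congr e, ← Nat.card_congr F]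
  | h_empty =>
    have : Subsingleton (Setoid PEmpty) := ⟨fun C D => by ext x; exact x.elim⟩
    exact (Finite.card_le_one_iff_subsingleton.2 this).trans (Nat.factorial_pos _)
  | @h_option α _ ih =>
    classical
    have hα : Finite α := inferInstance
    -- A partition is determined by its restriction to `α` and one chosen classmate of the new point
    -- (`none` if it is alone); this accounts for the factor n + 1.
    let F : Setoid (Option α) → Option α × Setoid α := fun C =>
      (if h : ∃ x : α, C none (some x) then some h.choose else none, C.comap some)
    have hF : Function.Injective F := by
      intro C D h
      have h1 : (F C).1 = (F D).1 := by rw [h]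
      have h2 : ∀ x y : α, C (some x) (some y) ↔ D (some x) (some y) := by
        intro x y
        have := congrArg (fun S : Option α × Setoid α => S.2 x y) h
        simpa [F, Setoid.comap_rel] using this
      have h3 : ∀ x : α, C none (some x) ↔ D none (some x) := by
        intro x
        by_cases hC : ∃ x : α, C none (some x) <;> by_cases hD : ∃ x : α, D none (some x)
        · simp only [F, dif_pos hC, dif_pos hD, Option.some.injEq] at h1
          have hc := hC.choose_spec
          have hd := hD.choose_spec
          rw [← h1] at hd
          exact ⟨fun k => D.trans hd ((h2 _ _).1 (C.trans (C.symm hc) k)),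
            fun k => C.trans hc ((h2 _ _).2 (D.trans (D.symm hd) k))⟩
        · simp [F, dif_pos hC, dif_neg hD] at h1
        · simp [F, dif_neg hC, dif_pos hD] at h1
        · exact ⟨fun k => (hC ⟨x, k⟩).elim, fun k => (hD ⟨x, k⟩).elim⟩
      ext x y
      rcases x with _ | x <;> rcases y with _ | y
      · exact ⟨fun _ => D.refl _, fun _ => C.refl _⟩
      · exact h3 y
      · exact ⟨fun k => D.symm ((h3 x).1 (C.symm k)), fun k => C.symm ((h3 x).2 (D.symm k))⟩
      · exact h2 x y
    have := Nat.card_le_card_of_injective F hF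
    rw [Nat.card_prod] at this
    refine this.trans ?_
    rw [Finite.card_option, Nat.factorial_succ]
    exact Nat.mul_le_mul_left _ ih

/-! ### Contracting an edge -/

section Contraction

variable {V : Type u} {E : Type v}

open Classical in
/-- Contraction of the edge `e`: the vertex `f e` is merged into `g e`. -/
noncomputable def mergeMap (f g : E → V) (e : E) (he : f e ≠ g e) (x : V) : {v : V // v ≠ f e} :=
  if h : x = f e then ⟨g e, he.symm⟩ else ⟨x, h⟩

theorem mergeMap_val (f g : E → V) (e : E) (he : f e ≠ g e) (x : {v : V // v ≠ f e}) :
    mergeMap f g e he x = x := by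
  simp [mergeMap, x.2]

theorem rel_mergeMap (f g : E → V) (e : E) (he : f e ≠ g e) {C : Setoid V}
    (hC : C (f e) (g e)) (x : V) : C x (mergeMap f g e he x) := by
  unfold mergeMap
  split_ifs with h
  · rw [h]; exact hC
  · exact C.refl _

theorem rel_mergeMap_iff (f g : E → V) (e : E) (he : f e ≠ g e) {C : Setoid V}
    (hC : C (f e) (g e)) (x y : V) :
    C (mergeMap f g e he x) (mergeMap f g e he y) ↔ C x y := by
  have hx := rel_mergeMap f g e he hC x
  have hy := rel_mergeMap f g e he hC y
  exact ⟨fun h => C.trans hx (C.trans h (C.symm hy)), fun h => C.trans (C.symm hx) (C.trans h hy)⟩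

end Contraction

/-! ### Double counting of small cuts and contractible edges -/

section Counting

variable {V : Type u} {E : Type v} [Fintype E]

open Classical in
/-- The edges with ends `f e`, `g e` in different classes of `C`. -/
noncomputable def crossEdges (f g : E → V) (C : Setoid V) : Finset E :=
  Finset.univ.filter fun e => ¬ C (f e) (g e)

/-- Every partition of the vertices into two nonempty parts is crossed by at least `χ` edges. -/
def CutsAtLeast (f g : E → V) (χ : ℕ) : Prop :=
  ∀ φ : V → Prop, (∃ x, φ x) → (∃ y, ¬ φ y) → χ ≤ (crossEdges f g (Setoid.ker φ)).card

/-- A cut of the contracted graph pulls back along `mergeMap` to a cut with definitionally the same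
crossing edges. -/
theorem CutsAtLeast.merge {f g : E → V} {χ : ℕ} (h : CutsAtLeast f g χ) (e : E)
    (he : f e ≠ g e) :
    CutsAtLeast (mergeMap f g e he ∘ f) (mergeMap f g e he ∘ g) χ := by
  rintro φ ⟨x, hx⟩ ⟨y, hy⟩
  have := h (φ ∘ mergeMap f g e he) ⟨x, by simpa [mergeMap_val] using hx⟩
    ⟨y, by simpa [mergeMap_val] using hy⟩
  refine this.trans (le_of_eq ?_)
  rfl

variable [Fintype V]

/-- If all cuts have size at least `χ`, there are at least `nχ/2` edges other than loops. -/
theorem CutsAtLeast.card_mul_le {f g : E → V} {χ : ℕ} (h : CutsAtLeast f g χ)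
    (hV : 2 ≤ Fintype.card V) :
    Fintype.card V * χ ≤ 2 * (crossEdges f g ⊥).card := by
  classical
  have : Nontrivial V := Fintype.one_lt_card_iff_nontrivial.1 hV
  -- Degree sum: each vertex against the rest is a cut, and a non-loop edge crosses only the cuts at
  -- its two ends.
  have h1 : ∑ v : V, χ ≤ ∑ v : V, (crossEdges f g (Setoid.ker (fun x => x = v))).card :=
    Finset.sum_le_sum fun v _ => h _ ⟨v, rfl⟩ (exists_ne v)
  have h2 : ∑ v : V, (crossEdges f g (Setoid.ker (fun x => x = v))).card
      ≤ ∑ e ∈ crossEdges f g ⊥, 2 := by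
    have h3 : ∀ v : V, (crossEdges f g (Setoid.ker (fun x => x = v))).card =
        ∑ e ∈ crossEdges f g ⊥, if f e = v ∨ g e = v then 1 else 0 := by
      intro v
      rw [← Finset.card_filter]
      congr 1
      ext e
      simp only [crossEdges, Finset.mem_filter, Finset.mem_univ, true_and, Setoid.ker_def,
        eq_iff_iff]
      grind
    simp_rw [h3]
    rw [Finset.sum_comm]
    refine Finset.sum_le_sum fun e _ => ?_
    rw [← Finset.card_filter]
    refine (Finset.card_le_card (t := {f e, g e}) ?_).trans Finset.card_le_two
    intro v
    simp only [Finset.mem_filter, Finset.mem_univ, true_and, Finset.mem_insert,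
      Finset.mem_singleton]
    grind
  simpa [mul_comm] using h1.trans h2

open Classical in
/-- The partitions crossed by at most `aχ/2` edges. -/
noncomputable def smallCuts (f g : E → V) (χ : ℕ) (a : ℝ) : Finset (Setoid V) :=
  letI := Fintype.ofFinite (Setoid V)
  Finset.univ.filter fun C => 2 * ((crossEdges f g C).card : ℝ) ≤ a * χ

theorem mem_smallCuts {f g : E → V} {χ : ℕ} {a : ℝ} {C : Setoid V} :
    C ∈ smallCuts f g χ a ↔ 2 * ((crossEdges f g C).card : ℝ) ≤ a * χ := by
  simp [smallCuts]

theorem card_smallCuts_le_factorial (f g : E → V) (χ : ℕ) (a : ℝ) :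
    (smallCuts f g χ a).card ≤ (Fintype.card V).factorial := by
  let _ := Fintype.ofFinite (Setoid V)
  have := Setoid.card_le_factorial V
  rw [Nat.card_eq_fintype_card, Nat.card_eq_fintype_card] at this
  exact (Finset.card_le_univ _).trans this

open Classical in
/-- The small cuts that do not separate the ends of `e` inject into the small cuts of the graph
with `e` contracted. -/
theorem card_smallCuts_rel_le (f g : E → V) (χ : ℕ) (a : ℝ) (e : E) (he : f e ≠ g e)
    [Fintype {v : V // v ≠ f e}] :
    ((smallCuts f g χ a).filter fun C => C (f e) (g e)).card ≤
      (smallCuts (mergeMap f g e he ∘ f) (mergeMap f g e he ∘ g) χ a).card := by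
  refine Finset.card_le_card_of_injOn (fun C => C.comap Subtype.val) ?_ ?_
  · intro C hC
    simp only [Finset.coe_filter, Set.mem_ofPred_eq, mem_smallCuts] at hC
    simp only [Finset.mem_coe, mem_smallCuts]
    refine le_trans (le_of_eq ?_) hC.1
    have : crossEdges (mergeMap f g e he ∘ f) (mergeMap f g e he ∘ g) (C.comap Subtype.val) =
        crossEdges f g C := by
      ext x
      simp only [crossEdges, Finset.mem_filter, Finset.mem_univ, true_and, Setoid.comap_rel,
        Function.comp_apply, rel_mergeMap_iff f g e he hC.2]
    rw [this]
  · intro C hC D hD h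
    simp only [Finset.coe_filter, Set.mem_ofPred_eq] at hC hD
    ext x y
    rw [← rel_mergeMap_iff f g e he hC.2, ← rel_mergeMap_iff f g e he hD.2]
    have := congrArg (fun S : Setoid {v : V // v ≠ f e} =>
      S (mergeMap f g e he x) (mergeMap f g e he y)) h
    simpa [Setoid.comap_rel] using this

open Classical in
/-- One contraction step in the count of small cuts. -/
theorem card_smallCuts_mul_le {f g : E → V} {χ : ℕ} (h : CutsAtLeast f g χ) (hχ : 0 < χ) {a : ℝ}
    (ha : 0 ≤ a) (hV : 2 ≤ Fintype.card V) {b : ℝ}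
    (hb : ∀ e, f e ≠ g e →
      (((smallCuts f g χ a).filter fun C => C (f e) (g e)).card : ℝ) ≤ b) :
    ((smallCuts f g χ a).card : ℝ) * (Fintype.card V - a) ≤ Fintype.card V * b := by
  set n : ℝ := (Fintype.card V : ℝ) with hn
  set M : ℝ := ((crossEdges f g ⊥).card : ℝ) with hM
  set N : ℝ := ((smallCuts f g χ a).card : ℝ) with hN
  have hdeg : n * χ ≤ 2 * M := by
    rw [hn, hM]
    exact_mod_cast h.card_mul_le hV
  have hn0 : 0 < n := by rw [hn]; exact_mod_cast (by omega : 0 < Fintype.card V)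
  have hM0 : 0 < M := by
    have : 0 < n * (χ : ℝ) := by positivity
    linarith
  -- Count the pairs of a non-loop edge and a small cut not separating its ends, first by edge and
  -- then by cut.
  have upper : ∑ e ∈ crossEdges f g ⊥,
      (((smallCuts f g χ a).filter fun C => C (f e) (g e)).card : ℝ) ≤ M * b := by
    rw [hM, ← nsmul_eq_mul]
    refine Finset.sum_le_card_nsmul _ _ _ fun e he => ?_
    have he' : f e ≠ g e := (Finset.mem_filter.1 he).2
    exact hb e he'
  have lower : N * (M - a * χ / 2) ≤ ∑ e ∈ crossEdges f g ⊥,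
      (((smallCuts f g χ a).filter fun C => C (f e) (g e)).card : ℝ) := by
    have hswap : ∑ e ∈ crossEdges f g ⊥,
        (((smallCuts f g χ a).filter fun C => C (f e) (g e)).card : ℝ) =
        ∑ C ∈ smallCuts f g χ a,
          (((crossEdges f g ⊥).filter fun e => C (f e) (g e)).card : ℝ) := by
      simp_rw [Finset.card_filter]
      push_cast
      exact Finset.sum_comm
    rw [hswap, hN, ← nsmul_eq_mul]
    refine Finset.card_nsmul_le_sum _ _ _ fun C hC => ?_
    rw [mem_smallCuts] at hC
    have hsplit : (crossEdges f g ⊥).card ≤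
        ((crossEdges f g ⊥).filter fun e => C (f e) (g e)).card + (crossEdges f g C).card := by
      rw [← Finset.card_filter_add_card_filter_not (s := crossEdges f g ⊥)
        (fun e => C (f e) (g e))]
      refine Nat.add_le_add_left (Finset.card_le_card fun e he => ?_) _
      simp only [crossEdges, Finset.mem_filter, Finset.mem_univ, true_and] at he ⊢
      exact he.2
    have : M ≤ (((crossEdges f g ⊥).filter fun e => C (f e) (g e)).card : ℝ) +
        (crossEdges f g C).card := by rw [hM]; exact_mod_cast hsplit
    linarith
  have hN0 : 0 ≤ N := by positivity
  have key : (N * (n - a)) * M ≤ (n * b) * M := by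
    -- This is `hdeg` multiplied by a/2.
    have h1 : M * (n - a) ≤ n * (M - a * χ / 2) := by nlinarith
    nlinarith [mul_le_mul_of_nonneg_left h1 hN0, mul_le_mul_of_nonneg_left (lower.trans upper) hn0.le]
  exact le_of_mul_le_mul_right key hM0

end Counting

/-! ### The bound n^a on the number of small cuts -/

/-- Iterates the contraction step from k + d vertices down to k, where k! bounds all partitions.
With m = k + j + 1 vertices the factor m - a equals j + 1 + t. -/
theorem card_smallCuts_mul_prod_le {E : Type v} [Fintype E] {χ : ℕ} (hχ : 0 < χ) (k : ℕ)
    (hk : 0 < k) {t : ℝ} (ht : 0 ≤ t) (ht1 : t ≤ 1) (d : ℕ) :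
    ∀ (V : Type u) [Fintype V] (f g : E → V), CutsAtLeast f g χ → Fintype.card V = k + d →
      ((smallCuts f g χ (k - t)).card : ℝ) * ∏ j ∈ Finset.range d, ((j : ℝ) + 1 + t) ≤
        ((k + d).factorial : ℝ) := by
  induction d with
  | zero =>
    intro V _ f g _ hV
    have := card_smallCuts_le_factorial f g χ (k - t)
    rw [hV] at this
    simpa using (Nat.cast_le (α := ℝ)).2 this
  | succ d ih =>
    classical
    intro V _ f g h hV
    set P := ∏ j ∈ Finset.range d, ((j : ℝ) + 1 + t) with hP
    have hP0 : 0 < P := Finset.prod_pos fun j _ => by positivity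
    have hk1 : (1 : ℝ) ≤ k := by exact_mod_cast hk
    have step := card_smallCuts_mul_le (f := f) (g := g) h hχ (a := k - t) (by linarith)
      (by omega) (b := ((k + d).factorial : ℝ) / P) (by
        intro e he
        have hc : Fintype.card {v : V // v ≠ f e} = k + d := by
          rw [Fintype.card_subtype_compl, Fintype.card_subtype_eq, hV]; omega
        rw [le_div_iff₀ hP0]
        refine le_trans ?_ (ih {v : V // v ≠ f e} _ _ (h.merge e he) hc)
        refine mul_le_mul_of_nonneg_right ?_ hP0.le
        have := card_smallCuts_rel_le f g χ (k - t) e he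
        refine le_trans (le_of_eq ?_) ((Nat.cast_le (α := ℝ)).2 this)
        congr!)
    rw [hV] at step
    rw [Finset.prod_range_succ, ← add_assoc k d 1, Nat.factorial_succ]
    push_cast at step ⊢
    have h2 := mul_le_mul_of_nonneg_right step hP0.le
    have h3 : (((k : ℝ) + (d + 1)) * (((k + d).factorial : ℝ) / P)) * P =
        ((k : ℝ) + (d + 1)) * ((k + d).factorial : ℝ) := by
      field_simp
    rw [h3] at h2
    calc _ = ((smallCuts f g χ (k - t)).card : ℝ) * (k + (d + 1) - (k - t)) * P := by ring
      _ ≤ _ := h2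
      _ = _ := by ring

/-- Bernoulli's inequality (1 + 1/(d+1))^t ≤ 1 + t/(d+1), valid for 0 ≤ t ≤ 1, drives the induction.
It replaces Gamma-function estimates for non-integral a. -/
theorem factorial_mul_rpow_le_prod {t : ℝ} (ht : 0 ≤ t) (ht1 : t ≤ 1) (d : ℕ) :
    (d.factorial : ℝ) * ((d : ℝ) + 1) ^ t ≤ ∏ j ∈ Finset.range d, ((j : ℝ) + 1 + t) := by
  induction d with
  | zero => simp
  | succ d ih =>
    rw [Finset.prod_range_succ, Nat.factorial_succ]
    have hd : (0 : ℝ) < (d : ℝ) + 1 := by positivity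
    have hb : (1 + 1 / ((d : ℝ) + 1)) ^ t ≤ 1 + t * (1 / ((d : ℝ) + 1)) :=
      rpow_one_add_le_one_add_mul_self (by
        have : 0 ≤ 1 / ((d : ℝ) + 1) := by positivity
        linarith) ht ht1
    have hs : ((d : ℝ) + 1 + 1) ^ t = ((d : ℝ) + 1) ^ t * (1 + 1 / ((d : ℝ) + 1)) ^ t := by
      rw [← Real.mul_rpow hd.le (by positivity)]
      congr 1
      field_simp
    push_cast
    rw [hs]
    have h2 : ((d : ℝ) + 1) * (1 + t * (1 / ((d : ℝ) + 1))) = d + 1 + t := by field_simp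
    calc ((d : ℝ) + 1) * (d.factorial : ℝ) * (((d : ℝ) + 1) ^ t * (1 + 1 / ((d : ℝ) + 1)) ^ t)
        = ((d.factorial : ℝ) * ((d : ℝ) + 1) ^ t) *
            (((d : ℝ) + 1) * (1 + 1 / ((d : ℝ) + 1)) ^ t) := by ring
      _ ≤ (∏ j ∈ Finset.range d, ((j : ℝ) + 1 + t)) *
            (((d : ℝ) + 1) * (1 + t * (1 / ((d : ℝ) + 1)))) := by gcongr
      _ = _ := by rw [h2]

/-- In a graph with `n` vertices all of whose cuts have size at least `χ`, at most `n ^ a`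
partitions of the vertices are crossed by at most `aχ/2` edges. -/
theorem card_smallCuts_le_rpow {V : Type u} {E : Type v} [Fintype V] [Fintype E] {f g : E → V}
    {χ : ℕ} (h : CutsAtLeast f g χ) (hχ : 0 < χ) {a : ℝ} (ha : 0 < a)
    (hV : 1 ≤ Fintype.card V) :
    ((smallCuts f g χ a).card : ℝ) ≤ (Fintype.card V : ℝ) ^ a := by
  have hn1 : (1 : ℝ) ≤ Fintype.card V := by exact_mod_cast hV
  by_cases hka : ⌈a⌉₊ ≤ Fintype.card V
  · obtain ⟨d, hd⟩ := Nat.exists_eq_add_of_le hka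
    set k := ⌈a⌉₊ with hk
    have hk0 : 0 < k := Nat.ceil_pos.2 ha
    obtain ⟨t, ht⟩ : ∃ t : ℝ, a = k - t := ⟨k - a, by ring⟩
    have ht0 : 0 ≤ t := by have := Nat.le_ceil a; rw [← hk] at this; linarith
    have ht1 : t ≤ 1 := by have := Nat.ceil_lt_add_one ha.le; rw [← hk] at this; linarith
    have h1 := card_smallCuts_mul_prod_le hχ k hk0 ht0 ht1 d V f g h hd
    rw [← ht] at h1
    have h2 := factorial_mul_rpow_le_prod ht0 ht1 d
    set N : ℝ := ((smallCuts f g χ a).card : ℝ) with hN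
    have hN0 : 0 ≤ N := Nat.cast_nonneg _
    have hdf : (0 : ℝ) < d.factorial := by positivity
    have hdt : (0 : ℝ) < ((d : ℝ) + 1) ^ t := by positivity
    -- The factor d + 1 is kept apart: divided by (d+1)^t it leaves (d+1)^(1-t) ≤ n^(1-t), so the
    -- exponents add up to exactly k - t = a.
    have hfac : (k + d).factorial ≤ d.factorial * ((d + 1) * (k + d) ^ (k - 1)) := by
      have e1 : (k + d).factorial = (d + 1).factorial * (d + 1 + 1).ascFactorial (k - 1) := by
        rw [Nat.factorial_mul_ascFactorial]
        congr 1; omega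
      have e2 : (d + 1 + 1).ascFactorial (k - 1) ≤ (d + 1 + (k - 1)) ^ (k - 1) :=
        Nat.ascFactorial_le_pow_add _ _
      have e3 : d + 1 + (k - 1) = k + d := by omega
      rw [e3] at e2
      rw [e1, Nat.factorial_succ]
      calc _ ≤ (d + 1) * d.factorial * (k + d) ^ (k - 1) := Nat.mul_le_mul_left _ e2
        _ = _ := by ring
    have hfac' : ((k + d).factorial : ℝ) ≤
        d.factorial * (((d : ℝ) + 1) * (k + d) ^ (k - 1)) := by exact_mod_cast hfac
    have h3 : d.factorial * (N * ((d : ℝ) + 1) ^ t) ≤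
        d.factorial * (((d : ℝ) + 1) * (k + d) ^ (k - 1)) := by
      calc _ = N * (d.factorial * ((d : ℝ) + 1) ^ t) := by ring
        _ ≤ _ := (mul_le_mul_of_nonneg_left h2 hN0).trans (h1.trans hfac')
    have h4 := le_of_mul_le_mul_left h3 hdf
    have hcard : (Fintype.card V : ℝ) = k + d := by rw [hd]; push_cast; ring
    rw [hcard] at hn1 ⊢
    have hd1 : (d : ℝ) + 1 ≤ k + d := by
      have : (1 : ℝ) ≤ k := by exact_mod_cast hk0
      linarith
    have h5 : (d : ℝ) + 1 ≤ ((d : ℝ) + 1) ^ t * ((k : ℝ) + d) ^ (1 - t) := by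
      calc (d : ℝ) + 1 = ((d : ℝ) + 1) ^ t * ((d : ℝ) + 1) ^ (1 - t) := by
            rw [← Real.rpow_add (by positivity), add_sub_cancel, Real.rpow_one]
        _ ≤ _ := by
            refine mul_le_mul_of_nonneg_left ?_ hdt.le
            exact Real.rpow_le_rpow (by positivity) hd1 (by linarith)
    have h6 : ((k : ℝ) + d) ^ a = ((k : ℝ) + d) ^ (1 - t) * ((k : ℝ) + d) ^ (k - 1) := by
      rw [← Real.rpow_natCast, ← Real.rpow_add (by linarith), Nat.cast_sub hk0, ht]
      congr 1; push_cast; ring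
    rw [h6]
    refine le_of_mul_le_mul_right (h4.trans ?_) hdt
    calc ((d : ℝ) + 1) * (k + d) ^ (k - 1)
        ≤ (((d : ℝ) + 1) ^ t * ((k : ℝ) + d) ^ (1 - t)) * (k + d) ^ (k - 1) := by gcongr
      _ = _ := by ring
  -- With n < a the trivial count suffices: n! ≤ n^n ≤ n^a.
  · have h1 := card_smallCuts_le_factorial f g χ a
    have h2 : ((Fintype.card V).factorial : ℝ) ≤ (Fintype.card V : ℝ) ^ (Fintype.card V) := by
      exact_mod_cast Nat.factorial_le_pow _
    have h3 : (Fintype.card V : ℝ) ≤ a := by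
      push Not at hka
      exact (Nat.lt_ceil.1 hka).le
    calc ((smallCuts f g χ a).card : ℝ) ≤ ((Fintype.card V).factorial : ℝ) := by exact_mod_cast h1
      _ ≤ _ := h2
      _ = (Fintype.card V : ℝ) ^ (Fintype.card V : ℝ) := (Real.rpow_natCast _ _).symm
      _ ≤ _ := Real.rpow_le_rpow_of_exponent_le hn1 h3

/-! ### Probabilities of heavy edge sets -/

/-- The probability that all edges of `S` are heavy. -/
theorem BCWGraph.Pr_forall_heavy {V : Type u} {E : Type v} [Fintype E] (G : BCWGraph V E)
    (S : Finset E) : G.Pr {I | ∀ e ∈ S, I e = true} = ∏ e ∈ S, G.prob e := by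
  classical
  -- Absorbing the indicator of the event into the edge factors lets the sum over instances factor
  -- as a product over edges.
  have h1 : ∀ I : E → Bool,
      (if I ∈ {I : E → Bool | ∀ e ∈ S, I e = true} then
        ∏ e, (if I e then G.prob e else 1 - G.prob e) else 0) =
      ∏ e, (if e ∈ S ∧ I e = false then 0 else if I e then G.prob e else 1 - G.prob e) := by
    intro I
    by_cases h : I ∈ {I : E → Bool | ∀ e ∈ S, I e = true}
    · rw [if_pos h]
      refine Finset.prod_congr rfl fun e _ => ?_
      have h' : ∀ e ∈ S, I e = true := h
      have hn : ¬ (e ∈ S ∧ I e = false) := by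
        rintro ⟨he, hf⟩
        simp [h' e he] at hf
      rw [if_neg hn]
    · rw [if_neg h]
      have h' : ¬ ∀ e ∈ S, I e = true := h
      push Not at h'
      obtain ⟨e, he, hf⟩ := h'
      refine (Finset.prod_eq_zero (Finset.mem_univ e) ?_).symm
      rw [if_pos ⟨he, by simpa using hf⟩]
  unfold BCWGraph.Pr
  have h2 := Finset.prod_univ_sum (fun _ : E => (Finset.univ : Finset Bool))
    (fun e b => if e ∈ S ∧ b = false then (0 : ℝ) else if b then G.prob e else 1 - G.prob e)
  rw [Fintype.piFinset_univ] at h2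
  refine (Finset.sum_congr rfl fun I _ => ?_).trans
    (h2.symm.trans (Eq.symm (Finset.prod_subset_one_on_sdiff (Finset.subset_univ S) ?_ ?_)))
  · convert h1 I
  · intro e he
    simp [(Finset.mem_sdiff.1 he).2]
  · intro e he
    simp [he]

theorem BCWGraph.Pr_mono {V : Type u} {E : Type v} [Fintype E] (G : BCWGraph V E)
    {A B : Set (E → Bool)} (h : A ⊆ B) : G.Pr A ≤ G.Pr B := by
  classical
  refine Finset.sum_le_sum fun I _ => ?_
  have hI : 0 ≤ ∏ e, (if I e then G.prob e else 1 - G.prob e) :=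
    Finset.prod_nonneg fun e _ => by
      split_ifs
      · exact (G.prob_pos e).le
      · linarith [G.prob_lt_one e]
  by_cases hA : I ∈ A
  · rw [if_pos hA, if_pos (h hA)]
  · rw [if_neg hA]
    split_ifs
    · exact hI
    · exact le_rfl

/-- The union bound. -/
theorem BCWGraph.Pr_exists_le {V : Type u} {E : Type v} [Fintype E] (G : BCWGraph V E)
    {ι : Type*} (F : Finset ι) (A : ι → Set (E → Bool)) :
    G.Pr {I | ∃ i ∈ F, I ∈ A i} ≤ ∑ i ∈ F, G.Pr (A i) := by
  classical
  unfold BCWGraph.Pr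
  rw [Finset.sum_comm]
  refine Finset.sum_le_sum fun I _ => ?_
  have hI : 0 ≤ ∏ e, (if I e then G.prob e else 1 - G.prob e) :=
    Finset.prod_nonneg fun e _ => by
      split_ifs
      · exact (G.prob_pos e).le
      · linarith [G.prob_lt_one e]
  have hnn : ∀ i ∈ F, 0 ≤
      (if I ∈ A i then ∏ e, (if I e then G.prob e else 1 - G.prob e) else 0) := by
    intro i _
    split_ifs
    · exact hI
    · exact le_rfl
  by_cases h : ∃ i ∈ F, I ∈ A i
  · rw [if_pos (show I ∈ {I | ∃ i ∈ F, I ∈ A i} from h)]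
    obtain ⟨i, hi, hA⟩ := h
    refine le_trans (le_of_eq ?_) (Finset.single_le_sum hnn hi)
    rw [if_pos hA]
  · rw [if_neg (show I ∉ {I | ∃ i ∈ F, I ∈ A i} from h)]
    exact Finset.sum_nonneg hnn

theorem BCWGraph.Pr_allHeavy {V : Type u} {E : Type v} [Fintype E] (G : BCWGraph V E) {p : ℝ}
    (hp : ∀ e ∈ G.zeroEdges, G.prob e = p) (C : Setoid V) :
    G.Pr (G.AllHeavy C) = p ^ G.zeroGraph.cutSize C := by
  classical
  set S : Finset E := (Subtype.val '' G.zeroGraph.crossing C).toFinset with hS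
  have h1 : G.AllHeavy C = {I | ∀ e ∈ S, I e = true} := by
    ext I
    simp only [BCWGraph.AllHeavy, hS, Set.mem_toFinset, Set.forall_mem_image]
  have h2 : ∀ e ∈ S, G.prob e = p := by
    intro e he
    rw [hS, Set.mem_toFinset] at he
    obtain ⟨e, _, rfl⟩ := he
    exact hp _ e.2
  rw [h1, G.Pr_forall_heavy, Finset.prod_congr rfl h2, Finset.prod_const]
  congr 1
  rw [hS, ← Set.ncard_eq_toFinset_card', Set.ncard_image_of_injective _ Subtype.val_injective]
  rfl

/-! ### Heavy cuts force a positive value -/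

theorem Multigraph.IsCut.exists_not_rel {V : Type u} {C : Setoid V} (h : Multigraph.IsCut C) :
    ∃ x y, ¬ C x y := by
  by_contra! hC
  have : C.classes ⊆ {Set.univ} := by
    rintro _ ⟨y, rfl⟩
    simp only [Set.mem_singleton_iff]
    exact Set.eq_univ_of_forall fun x => hC x y
  have := (Set.ncard_le_ncard this).trans_eq (Set.ncard_singleton _)
  unfold Multigraph.IsCut at h
  omega

theorem Multigraph.isCut_ker {V : Type u} [Finite V] {φ : V → Prop} (h : ∃ x, φ x)
    (h' : ∃ y, ¬ φ y) : Multigraph.IsCut (Setoid.ker φ) := by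
  obtain ⟨x, hx⟩ := h
  obtain ⟨y, hy⟩ := h'
  refine (Set.one_lt_ncard (Set.toFinite _)).2
    ⟨_, Setoid.mem_classes _ x, _, Setoid.mem_classes _ y, fun hxy => ?_⟩
  have : x ∈ {z | Setoid.ker φ z y} := by rw [← hxy]; exact (Setoid.ker φ).refl x
  have h2 : φ x = φ y := this
  exact hy (h2 ▸ hx)

/-- If all zero edges crossing a cut are heavy, then the property is positive. -/
theorem BCWGraph.allHeavy_subset_positiveEvent {V : Type u} {E : Type v} [Finite V] [Finite E]
    (G : BCWGraph V E) {Φ : WeightedGraph.{u, v} → ℝ≥0∞} (hΦ : IsDistanceCumulative Φ)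
    (hG : G.graph.Connected) (hh : ∀ e, 0 < G.heavy e) {C : Setoid V}
    (hC : Multigraph.IsCut C) : G.AllHeavy C ⊆ G.positiveEvent Φ := by
  intro I hI
  change 0 < Φ (G.realize I)
  rw [pos_iff_ne_zero]
  intro h0
  have hconn := (hΦ.positive (G.realize I) hG).1 h0
  obtain ⟨x, y, hxy⟩ := hC.exists_not_rel
  apply hxy
  -- An edge of realized weight 0 is in its light phase and has light weight 0. It is thus a zero
  -- edge that is not heavy, so it cannot cross `C`.
  have hadj : ∀ a b : V, (((G.realize I).graph.restrict
      {e | (G.realize I).weight e = 0}).toSimple).Adj a b → C a b := by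
    intro a b hab
    obtain ⟨⟨e, he⟩, hends⟩ := ((SimpleGraph.fromEdgeSet_adj _).1 hab).1
    by_contra hnot
    have hw : (if I e then G.heavy e else G.light e) = 0 := he
    cases hIe : I e with
    | true =>
      rw [hIe, if_pos rfl] at hw
      exact (hh e).ne' hw
    | false =>
      rw [hIe, if_neg (by simp)] at hw
      have := hI ⟨e, hw⟩ ⟨a, b, hends, hnot⟩
      simp [hIe] at this
  obtain ⟨w⟩ := hconn.preconnected x y
  clear hxy
  induction w with
  | nil => exact C.refl _
  | cons h _ ih => exact C.trans (hadj _ _ h) ih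

/-! ### Arithmetic of c and α -/

theorem four_add_half_lt_cutConst : 4 + 1 / 2 < cutConst := by
  unfold cutConst
  have : (4 : ℝ) < Real.sqrt 17 := by
    rw [Real.lt_sqrt (by norm_num)]; norm_num
  linarith

/-- The defining equation of c: it cancels the part of the exponent of n in `tail_le` that does not
depend on ε. -/
theorem cutConst_quadratic : (cutConst - 1) * (cutConst - 2) / 2 = cutConst := by
  unfold cutConst
  have : Real.sqrt 17 * Real.sqrt 17 = 17 := Real.mul_self_sqrt (by norm_num)
  nlinarith

theorem one_lt_cutAlpha {n : ℕ} (hn : 2 ≤ n) {ε : ℝ} (hε : 0 < ε) (hε1 : ε ≤ 1) :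
    1 < cutAlpha n ε := by
  have h1 : 0 ≤ Real.log (1 / ε) := Real.log_nonneg (by rw [le_div_iff₀ hε]; linarith)
  have h2 : 0 < Real.log n := Real.log_pos (by exact_mod_cast hn)
  have h3 := div_nonneg h1 h2.le
  have := four_add_half_lt_cutConst
  unfold cutAlpha
  linarith

/-- The exponent `cutAlpha n ε` makes the tail bound for large cuts small relative to `x`. -/
theorem tail_le {n : ℕ} (hn : 2 ≤ n) {ε x : ℝ} (hε : 0 < ε) (hε0 : ε ≤ (1 / 32) ^ 4)
    (hx : 0 < x) (hxn : x ≤ (n : ℝ) ^ (-cutConst)) :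
    16 / 3 * ((n : ℝ) ^ (2 : ℝ) * x) ^ cutAlpha n ε ≤ ε * x / 4 := by
  have hn0 : (0 : ℝ) < n := by exact_mod_cast (by omega : 0 < n)
  have hlog : 0 < Real.log n := Real.log_pos (by exact_mod_cast hn)
  have hα := one_lt_cutAlpha hn hε (hε0.trans (by norm_num))
  have hc := four_add_half_lt_cutConst
  set α := cutAlpha n ε with hαdef
  -- One factor x is kept for the conclusion; only the remaining x^(α-1) is estimated by n^(-c).
  have h1 : x ^ α ≤ x * (n : ℝ) ^ (-cutConst * (α - 1)) := by
    have : x ^ α = x * x ^ (α - 1) := by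
      rw [← Real.rpow_one_add' hx.le (by linarith)]; congr 1; ring
    rw [this, Real.rpow_mul hn0.le]
    gcongr
  have h2 : (n : ℝ) ^ (2 * α + -cutConst * (α - 1)) = ε ^ ((cutConst - 2) / 2) := by
    rw [Real.rpow_def_of_pos hn0, Real.rpow_def_of_pos hε]
    congr 1
    have e1 : Real.log (1 / ε) = - Real.log ε := by rw [one_div, Real.log_inv]
    have e2 : 2 * α = cutConst - 1 - Real.log ε / Real.log n := by
      rw [hαdef, cutAlpha, e1]; ring
    have e3 : Real.log n * (Real.log ε / Real.log n) = Real.log ε := by field_simp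
    have e4 : α = (cutConst - 1 - Real.log ε / Real.log n) / 2 := by linarith
    rw [e4]
    linear_combination (-Real.log n) * cutConst_quadratic + ((cutConst - 2) / 2) * e3
  -- Since (c-4)/2 > 1/4, the surplus power of ε is at most ε^(1/4) ≤ 1/32, and (16/3)/32 = 1/6 ≤
  -- 1/4.
  have h3 : ε ^ ((cutConst - 2) / 2) ≤ ε * (1 / 32) := by
    have e1 : ε ^ ((cutConst - 2) / 2) = ε * ε ^ ((cutConst - 4) / 2) := by
      rw [← Real.rpow_one_add' hε.le (by linarith)]; congr 1; ring
    rw [e1]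
    gcongr
    calc ε ^ ((cutConst - 4) / 2) ≤ ε ^ (1 / 4 : ℝ) :=
          Real.rpow_le_rpow_of_exponent_ge hε (hε0.trans (by norm_num)) (by linarith)
      _ ≤ ((1 / 32) ^ 4) ^ (1 / 4 : ℝ) := Real.rpow_le_rpow hε.le hε0 (by norm_num)
      _ = 1 / 32 := by
          rw [← Real.rpow_natCast, ← Real.rpow_mul (by norm_num)]
          norm_num
  calc 16 / 3 * ((n : ℝ) ^ (2 : ℝ) * x) ^ α = 16 / 3 * ((n : ℝ) ^ (2 * α) * x ^ α) := by
        rw [Real.mul_rpow (by positivity) hx.le, ← Real.rpow_mul hn0.le]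
    _ ≤ 16 / 3 * ((n : ℝ) ^ (2 * α) * (x * (n : ℝ) ^ (-cutConst * (α - 1)))) := by gcongr
    _ = 16 / 3 * (ε ^ ((cutConst - 2) / 2) * x) := by
        rw [← h2, Real.rpow_add hn0]; ring
    _ ≤ 16 / 3 * (ε * (1 / 32) * x) := by gcongr
    _ ≤ ε * x / 4 := by nlinarith [mul_pos hε hx]


/-! ### The geometric tail sum -/

/-- The weights `p ^ |C|` of the partitions `C` crossed by more than `αχ` edges have a
geometrically small sum. -/
theorem sum_pow_crossEdges_le {V : Type u} {E : Type v} [Fintype V] [Fintype E] {f g : E → V}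
    {χ : ℕ} (h : CutsAtLeast f g χ) (hχ : 0 < χ) (hV : 2 ≤ Fintype.card V) {p : ℝ} (hp : 0 < p)
    (hp1 : p < 1) (hx : p ^ χ ≤ (Fintype.card V : ℝ) ^ (-4 : ℝ)) {α : ℝ} (hα : 0 < α)
    (F : Finset (Setoid V)) (hF : ∀ C ∈ F, α * χ < ((crossEdges f g C).card : ℝ)) :
    ∑ C ∈ F, p ^ (crossEdges f g C).card ≤
      16 / 3 * ((Fintype.card V : ℝ) ^ (2 : ℝ) * p ^ χ) ^ α := by
  classical
  obtain ⟨n, hn⟩ : ∃ n : ℝ, (Fintype.card V : ℝ) = n := ⟨_, rfl⟩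
  obtain ⟨x, hxd⟩ : ∃ x : ℝ, p ^ χ = x := ⟨_, rfl⟩
  have hn2 : 2 ≤ n := by rw [← hn]; exact_mod_cast hV
  have hn0 : 0 < n := by linarith
  have hx0 : 0 < x := by rw [← hxd]; positivity
  have hx1 : x ≤ 1 := by rw [← hxd]; exact pow_le_one₀ hp.le hp1.le
  have hχ0 : (0 : ℝ) < χ := by exact_mod_cast hχ
  rw [hn, hxd] at hx ⊢
  obtain ⟨l, hl⟩ : ∃ l : ℝ, Real.logb 2 n = l := ⟨_, rfl⟩
  have hl0 : 0 < l := by rw [← hl]; exact Real.logb_pos (by norm_num) (by linarith)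
  have hnl : n ^ (1 / l) = 2 := by
    have : n = 2 ^ l := by rw [← hl, Real.rpow_logb (by norm_num) (by norm_num) hn0]
    rw [this, ← Real.rpow_mul (by norm_num), mul_one_div_cancel hl0.ne', Real.rpow_one]
  -- Buckets have width 1/log₂ n in |C|/χ. Per bucket the count bound grows by n^(2/l) = 4 while
  -- x^(1/l) ≤ n^(-4/l) = 1/16, so the ratio is at most 1/4. Using the upper end of a bucket for the
  -- count costs the extra factor 4, whence 4 · 4/3 = 16/3.
  let bucket : Setoid V → ℕ := fun C => ⌊(((crossEdges f g C).card : ℝ) / χ - α) * l⌋₊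
  have hcard : ∀ i : ℕ, ((F.filter fun C => bucket C = i).card : ℝ) ≤
      n ^ (2 * (α + (i + 1) * (1 / l))) := by
    intro i
    have hpos : 0 < 2 * (α + (i + 1) * (1 / l)) := by positivity
    have h1 := card_smallCuts_le_rpow h hχ hpos (by omega)
    rw [hn] at h1
    refine le_trans (Nat.cast_le.2 (Finset.card_le_card fun C hC => ?_)) h1
    rw [Finset.mem_filter] at hC
    rw [mem_smallCuts]
    have h2 : (((crossEdges f g C).card : ℝ) / χ - α) * l < i + 1 := by
      have := Nat.lt_floor_add_one ((((crossEdges f g C).card : ℝ) / χ - α) * l)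
      rwa [show ⌊(((crossEdges f g C).card : ℝ) / χ - α) * l⌋₊ = i from hC.2] at this
    have h3 : ((crossEdges f g C).card : ℝ) / χ - α < (i + 1) * (1 / l) := by
      rw [mul_one_div, lt_div_iff₀ hl0]; exact h2
    have h4 : ((crossEdges f g C).card : ℝ) / χ ≤ α + (i + 1) * (1 / l) := by linarith
    rw [div_le_iff₀ hχ0] at h4
    linarith
  have hpow : ∀ C ∈ F, p ^ (crossEdges f g C).card ≤ x ^ (α + bucket C * (1 / l)) := by
    intro C hC
    have h1 : α < ((crossEdges f g C).card : ℝ) / χ := by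
      rw [lt_div_iff₀ hχ0]; exact hF C hC
    have h2 : (bucket C : ℝ) ≤ (((crossEdges f g C).card : ℝ) / χ - α) * l :=
      Nat.floor_le (mul_nonneg (by linarith) hl0.le)
    have h3 : α + bucket C * (1 / l) ≤ ((crossEdges f g C).card : ℝ) / χ := by
      rw [mul_one_div]
      have := (div_le_iff₀ hl0).2 h2
      linarith
    calc p ^ (crossEdges f g C).card = x ^ (((crossEdges f g C).card : ℝ) / χ) := by
          rw [← hxd, ← Real.rpow_natCast p χ, ← Real.rpow_mul hp.le, mul_div_cancel₀ _ hχ0.ne',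
            Real.rpow_natCast]
      _ ≤ _ := Real.rpow_le_rpow_of_exponent_ge hx0 hx1 h3
  have hq : (n ^ (2 : ℝ) * x) ^ (1 / l) ≤ 1 / 4 := by
    have h1 : n ^ (2 : ℝ) * x ≤ n ^ (-2 : ℝ) := by
      calc n ^ (2 : ℝ) * x ≤ n ^ (2 : ℝ) * n ^ (-4 : ℝ) := by gcongr
        _ = n ^ (-2 : ℝ) := by rw [← Real.rpow_add hn0]; norm_num
    calc (n ^ (2 : ℝ) * x) ^ (1 / l) ≤ (n ^ (-2 : ℝ)) ^ (1 / l) :=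
          Real.rpow_le_rpow (by positivity) h1 (by positivity)
      _ = (n ^ (1 / l)) ^ (-2 : ℝ) := by
          rw [← Real.rpow_mul hn0.le, mul_comm, Real.rpow_mul hn0.le]
      _ = 1 / 4 := by
          rw [hnl, Real.rpow_neg (by norm_num)]; norm_num
  have hbucket : ∀ i : ℕ, ∑ C ∈ F with bucket C = i, p ^ (crossEdges f g C).card ≤
      4 * (n ^ (2 : ℝ) * x) ^ α * (1 / 4) ^ i := by
    intro i
    calc ∑ C ∈ F with bucket C = i, p ^ (crossEdges f g C).card
        ≤ (F.filter fun C => bucket C = i).card • x ^ (α + i * (1 / l)) := by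
          refine Finset.sum_le_card_nsmul _ _ _ fun C hC => ?_
          rw [Finset.mem_filter] at hC
          rw [← hC.2]
          exact hpow C hC.1
      _ ≤ n ^ (2 * (α + (i + 1) * (1 / l))) * x ^ (α + i * (1 / l)) := by
          rw [nsmul_eq_mul]
          gcongr
          exact hcard i
      _ = (n ^ (1 / l)) ^ (2 : ℝ) * (n ^ (2 : ℝ) * x) ^ α *
            ((n ^ (2 : ℝ) * x) ^ (1 / l)) ^ i := by
          have e0 : ((n ^ (2 : ℝ) * x) ^ (1 / l)) ^ i = (n ^ (2 : ℝ) * x) ^ (1 / l * i) := by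
            rw [Real.rpow_mul (by positivity), Real.rpow_natCast]
          rw [e0, Real.mul_rpow (by positivity) hx0.le, Real.mul_rpow (by positivity) hx0.le,
            ← Real.rpow_mul hn0.le, ← Real.rpow_mul hn0.le, ← Real.rpow_mul hn0.le]
          have e1 : 2 * (α + ((i : ℝ) + 1) * (1 / l)) =
              1 / l * 2 + 2 * α + 2 * (1 / l * i) := by ring
          rw [e1, Real.rpow_add hn0, Real.rpow_add hn0, Real.rpow_add hx0, mul_comm (i : ℝ)]
          ring
      _ ≤ 4 * (n ^ (2 : ℝ) * x) ^ α * (1 / 4) ^ i := by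
          rw [hnl]
          have : (2 : ℝ) ^ (2 : ℝ) = 4 := by norm_num
          rw [this]
          gcongr
  have hA : 0 ≤ 4 * (n ^ (2 : ℝ) * x) ^ α := by positivity
  calc ∑ C ∈ F, p ^ (crossEdges f g C).card
      = ∑ i ∈ F.image bucket, ∑ C ∈ F with bucket C = i, p ^ (crossEdges f g C).card :=
        (Finset.sum_fiberwise_of_maps_to (fun C hC => Finset.mem_image_of_mem _ hC) _).symm
    _ ≤ ∑ i ∈ F.image bucket, 4 * (n ^ (2 : ℝ) * x) ^ α * (1 / 4) ^ i :=
        Finset.sum_le_sum fun i _ => hbucket i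
    _ = 4 * (n ^ (2 : ℝ) * x) ^ α * ∑ i ∈ F.image bucket, (1 / 4 : ℝ) ^ i := by
        rw [Finset.mul_sum]
    _ ≤ 4 * (n ^ (2 : ℝ) * x) ^ α * ∑' i : ℕ, (1 / 4 : ℝ) ^ i := by
        refine mul_le_mul_of_nonneg_left ?_ hA
        exact (summable_geometric_of_lt_one (by norm_num) (by norm_num)).sum_le_tsum _
          fun i _ => by positivity
    _ = 16 / 3 * (n ^ (2 : ℝ) * x) ^ α := by
        rw [tsum_geometric_of_lt_one (by norm_num) (by norm_num)]; ring

/-! ### From unordered ends to end maps -/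

/-- Any choice of orientation works, because the relation `C` is symmetric. -/
theorem Multigraph.cutSize_eq_card_crossEdges {V : Type u} {E : Type v} [Fintype E]
    (G : Multigraph V E) (C : Setoid V) :
    G.cutSize C = (crossEdges (fun e => (Quot.out (G.ends e)).1)
      (fun e => (Quot.out (G.ends e)).2) C).card := by
  unfold Multigraph.cutSize
  rw [← Set.ncard_coe_finset]
  congr 1
  ext e
  have hout : s((Quot.out (G.ends e)).1, (Quot.out (G.ends e)).2) = G.ends e :=
    Quot.out_eq (G.ends e)
  simp only [crossEdges, Finset.coe_filter, Finset.mem_univ, true_and, Multigraph.crossing,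
    Set.mem_ofPred_eq]
  constructor
  · rintro ⟨x, y, hxy, hC⟩ hC'
    rcases Sym2.eq_iff.1 (hout.trans hxy) with ⟨h1, h2⟩ | ⟨h1, h2⟩
    · rw [h1, h2] at hC'; exact hC hC'
    · rw [h1, h2] at hC'; exact hC (C.symm hC')
  · intro hC
    exact ⟨_, _, hout.symm, hC⟩

theorem Multigraph.cutsAtLeast_minCutSize {V : Type u} {E : Type v} [Finite V] [Fintype E]
    (G : Multigraph V E) :
    CutsAtLeast (fun e => (Quot.out (G.ends e)).1) (fun e => (Quot.out (G.ends e)).2)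
      G.minCutSize := by
  intro φ h h'
  rw [← G.cutSize_eq_card_crossEdges]
  exact Nat.sInf_le ⟨_, Multigraph.isCut_ker h h', rfl⟩

theorem Multigraph.exists_cutSize_eq_minCutSize {V : Type u} {E : Type v} [Finite V]
    [Nontrivial V] (G : Multigraph V E) :
    ∃ C : Setoid V, Multigraph.IsCut C ∧ G.cutSize C = G.minCutSize := by
  obtain ⟨x, y, hxy⟩ := exists_pair_ne V
  exact Nat.sInf_mem (s := {k | ∃ C : Setoid V, Multigraph.IsCut C ∧ G.cutSize C = k})
    ⟨_, _, Multigraph.isCut_ker (φ := fun z => z = x) ⟨x, rfl⟩ ⟨y, hxy.symm⟩, rfl⟩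

/-! ### The union bound -/

theorem mainTheorem5 :
    ∃ ε₀ : ℝ, 0 < ε₀ ∧
      ∀ (V : Type u) [Fintype V] (E : Type v) [Fintype E] (G : BCWGraph V E)
        (Φ : WeightedGraph.{u, v} → ℝ≥0∞) (p ε : ℝ),
        IsDistanceCumulative Φ →
        2 ≤ Fintype.card V →
        G.graph.Connected →
        (∀ e, 0 < G.heavy e) →
        (∀ e ∈ G.zeroEdges, G.prob e = p) →
        G.Pr (G.positiveEvent Φ) < (Fintype.card V : ℝ) ^ (-cutConst) →
        0 < ε → ε ≤ ε₀ →
        G.Pr {I | ∃ C : Setoid V, G.zeroGraph.IsCompactCut C ∧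
              C ∉ G.zeroGraph.compactCutsUpTo
                (cutAlpha (Fintype.card V) ε * (G.zeroGraph.minCutSize : ℝ)) ∧
              I ∈ G.AllHeavy C}
            ≤ ε * p ^ G.zeroGraph.minCutSize / 4 ∧
          ε * p ^ G.zeroGraph.minCutSize / 4 ≤ ε * G.Pr (G.positiveEvent Φ) / 4 := by
  refine ⟨(1 / 32) ^ 4, by norm_num, ?_⟩
  intro V _ E _ G Φ p ε hΦ hV hG hh hp hPr hε hε0
  classical
  have : Nontrivial V := Fintype.one_lt_card_iff_nontrivial.1 hV
  obtain ⟨C₀, hC₀, hsize⟩ := G.zeroGraph.exists_cutSize_eq_minCutSize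
  have hle : p ^ G.zeroGraph.minCutSize ≤ G.Pr (G.positiveEvent Φ) := by
    rw [← hsize, ← G.Pr_allHeavy hp]
    exact G.Pr_mono (G.allHeavy_subset_positiveEvent hΦ hG hh hC₀)
  refine ⟨?_, by gcongr⟩
  set χ := G.zeroGraph.minCutSize with hχdef
  have hc := four_add_half_lt_cutConst
  have hn1 : (1 : ℝ) < Fintype.card V := by exact_mod_cast hV
  have hlt : p ^ χ < (Fintype.card V : ℝ) ^ (-cutConst) := hle.trans_lt hPr
  -- If χ = 0 then p^χ = 1, which is not below n^(-c).
  have hχ : 0 < χ := by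
    rw [Nat.pos_iff_ne_zero]
    intro h0
    rw [h0, pow_zero] at hlt
    exact absurd hlt (not_lt.2 (Real.rpow_le_one_of_one_le_of_nonpos hn1.le (by linarith)))
  -- A zero edge is needed to place p in (0, 1): p is tied to the graph only through such edges.
  obtain ⟨e, -⟩ : (G.zeroGraph.crossing C₀).Nonempty :=
    Set.nonempty_of_ncard_ne_zero (by
      change G.zeroGraph.cutSize C₀ ≠ 0
      omega)
  have hp0 : 0 < p := by rw [← hp e e.2]; exact G.prob_pos e
  have hp1 : p < 1 := by rw [← hp e e.2]; exact G.prob_lt_one e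
  set α := cutAlpha (Fintype.card V) ε with hα
  have hα1 : 1 < α := one_lt_cutAlpha hV hε (hε0.trans (by norm_num))
  let _ : Fintype (Setoid V) := Fintype.ofFinite _
  let F : Finset (Setoid V) :=
    Finset.univ.filter fun C => α * χ < (G.zeroGraph.cutSize C : ℝ)
  calc _ ≤ G.Pr {I | ∃ C ∈ F, I ∈ G.AllHeavy C} := by
        refine G.Pr_mono ?_
        rintro I ⟨C, hC, hC', hI⟩
        refine ⟨C, ?_, hI⟩
        simp only [F, Finset.mem_filter, Finset.mem_univ, true_and]
        by_contra hcon
        exact hC' ⟨hC, not_lt.1 hcon⟩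
    _ ≤ ∑ C ∈ F, G.Pr (G.AllHeavy C) := G.Pr_exists_le F _
    _ = ∑ C ∈ F, p ^ (crossEdges (fun e => (Quot.out (G.zeroGraph.ends e)).1)
          (fun e => (Quot.out (G.zeroGraph.ends e)).2) C).card := by
        refine Finset.sum_congr rfl fun C _ => ?_
        rw [G.Pr_allHeavy hp, Multigraph.cutSize_eq_card_crossEdges]
    _ ≤ 16 / 3 * ((Fintype.card V : ℝ) ^ (2 : ℝ) * p ^ χ) ^ α := by
        refine sum_pow_crossEdges_le G.zeroGraph.cutsAtLeast_minCutSize hχ hV hp0 hp1 ?_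
          (by linarith) F ?_
        · exact hlt.le.trans (Real.rpow_le_rpow_of_exponent_le hn1.le (by linarith))
        · intro C hC
          rw [← Multigraph.cutSize_eq_card_crossEdges]
          exact (Finset.mem_filter.1 hC).2
    _ ≤ _ := tail_le hV hε hε0 (by positivity) hlt.le
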